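/- Let $R$ be a real closed field with its unique order, let $v$ be its natural valuation (the valuation, written additively, whose valuation ring consists of the elements bounded in absolute value by a rational number), and let $\Gamma$ be the value group of $v$. For an order $P$ of a field $K$, given by its set of nonnegative elements, let $A(P)=\{a\in K : q\pm a\in P \text{ for some } q\in\mathbb Q,\ q>0\}$ and $I(P)=\{a\in K : q\pm a\in P \text{ for all } q\in\mathbb Q,\ q>0\}$. Then $A(P)$ is a valuation ring with maximal ideal $I(P)$, and its residue field $k(P)=A(P)/I(P)$ is Archimedean ordered, hence has a unique order embedding in $\mathbb R$. Let $\lambda(P): K\to\mathbb R\cup\{\infty\}$ be the associated $\mathbb R$-place: on $A(P)$ it is the composition $A(P)\to k(P)\hookrightarrow\mathbb R$, and it is $\infty$ outside $A(P)$. Let $P_1,P_2$ be orders of $R(X)$ and let $(A_i,B_i)$ be the corresponding cuts in $R$: $A_i=\{a\in R: a<X \text{ in } P_i\}$, $B_i=\{b\in R: X<b \text{ in } P_i\}$. Put $S_i=\{v(b-a): a\in A_i,\ b\in B_i\}\subseteq\Gamma$. Then: 1. If $S_1\neq S_2$, then $\lambda(P_1)\neq\lambda(P_2)$. Suppose now that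 $A_1\subseteq A_2$ (the sets $A_1,A_2$ are always comparable, so this can be achieved by exchanging $P_1$ and $P_2$), and put $U=\{v(a'-a): a,a'\in B_1\cap A_2,\ a<a'\}\subseteq\Gamma$. Then: 2. If $S_1=S_2=S$ and $S\cap U\neq\emptyset$, then $\lambda(P_1)\neq\lambda(P_2)$. 3. If $S_1=S_2=S$ and $S\cap U=\emptyset$, then $\lambda(P_1)=\lambda(P_2)$. 4. Consequently, if $P_1\neq P_2$, then $\lambda(P_1)=\lambda(P_2)$ if and only if one of the following holds: (a) (principal step) there is $a\in R$ with $A_1=(-\infty,a)$, $B_1=[a,\infty)$, $A_2=(-\infty,a]$, $B_2=(a,\infty)$; (b) (the two improper cuts) $(A_1,B_1)=(\emptyset,R)$ and $(A_2,B_2)=(R,\emptyset)$; (c) (abnormal gaps close to each other) $(A_1,B_1)$ and $(A_2,B_2)$ are abnormal gaps with $S_1=S_2=S$ and $S\cap U=\emptyset$. Here a cut $(A,B)$ is a gap if $A$ and $B$ are nonempty, $A$ has no greatest and $B$ no least element; it is normal if for every $c>0$ in $R$ there are $a\in A$, $b\in B$ with $b-a<c$; an abnormal gap is a gap that is not normal.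 -/

import Mathlib

/-! ### Orders of a field and their real places

An order of a field `K` is a subset `P` with `P + P ⊆ P`, `P * P ⊆ P`, `P ∪ -P = K` and `-1 ∉ P`,
that is, the set of nonnegative elements of a linear order compatible with the field structure.
In Mathlib this is a `P : RingPreordering K` with `P.IsOrdering`. -/

namespace FieldOrder

/-- The linear order `a ≤ b ↔ b - a ∈ P` of `K`, whose set of nonnegative elements is `P`. -/
noncomputable abbrev linearOrder {K : Type*} [Field K] (P : RingPreordering K) [P.IsOrdering] :
    LinearOrder K where
  le a b := b - a ∈ P
  le_refl a := by simp
  le_trans a b c hab hbc := by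
    have h := add_mem hbc hab
    rwa [sub_add_sub_cancel] at h
  le_antisymm a b hab hba := by
    have h : -(b - a) ∈ P := by rwa [neg_sub]
    exact (sub_eq_zero.1 (RingPreordering.eq_zero_of_mem_of_neg_mem hab h)).symm
  le_total a b := by
    rcases mem_or_neg_mem P (b - a) with h | h
    · exact Or.inl h
    · exact Or.inr (by rwa [neg_sub] at h)
  toDecidableLE := Classical.decRel _

theorem isStrictOrderedRing {K : Type*} [Field K] (P : RingPreordering K) [P.IsOrdering] :
    letI := linearOrder P
    IsStrictOrderedRing K := by
  let _ := linearOrder P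
  have : IsOrderedAddMonoid K :=
    { add_le_add_left := fun a b h c => by
        change (b + c) - (a + c) ∈ P
        rw [add_sub_add_right_eq_sub]
        exact h }
  have : ZeroLEOneClass K := ⟨by change (1 : K) - 0 ∈ P; rw [sub_zero]; exact one_mem P⟩
  have : IsOrderedRing K := IsOrderedRing.of_mul_nonneg fun a b ha hb => by
    change a * b - 0 ∈ P
    have ha' : a - 0 ∈ P := ha
    have hb' : b - 0 ∈ P := hb
    rw [sub_zero] at *
    exact mul_mem ha' hb'
  exact IsOrderedRing.toIsStrictOrderedRing K

theorem isOrderedRing {K : Type*} [Field K] (P : RingPreordering K) [P.IsOrdering] :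
    letI := linearOrder P
    IsOrderedRing K := by
  let _ := linearOrder P
  have : IsStrictOrderedRing K := isStrictOrderedRing P
  infer_instance

/-- The valuation ring `A(P) = {a ∈ K : q ± a ∈ P for some positive rational q}`, as a set. -/
def finiteElements {K : Type*} [Field K] (P : RingPreordering K) : Set K :=
  {a | ∃ q : ℚ, 0 < q ∧ (q : K) + a ∈ P ∧ (q : K) - a ∈ P}

/-- For the order `P`, the valuation ring `A(P)` consists of the elements whose
Archimedean class is nonnegative. -/
theorem mem_finiteElements_iff {K : Type*} [Field K] (P : RingPreordering K) [P.IsOrdering]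
    (a : K) :
    letI := linearOrder P
    haveI : IsOrderedRing K := isOrderedRing P
    a ∈ finiteElements P ↔ 0 ≤ ArchimedeanClass.mk a := by
  let _ := linearOrder P
  have : IsStrictOrderedRing K := isStrictOrderedRing P
  have key : a ∈ finiteElements P ↔ ∃ q : ℚ, 0 < q ∧ |a| ≤ (q : K) := by
    refine exists_congr fun q => and_congr_right fun _ => ?_
    rw [abs_le]
    refine and_congr ?_ Iff.rfl
    change _ ↔ a - -(q : K) ∈ P
    rw [sub_neg_eq_add, add_comm]
  rw [key, ← ArchimedeanClass.mk_one, ArchimedeanClass.mk_le_mk]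
  constructor
  · rintro ⟨q, -, hq⟩
    obtain ⟨n, hn⟩ := exists_nat_ge q
    refine ⟨n, hq.trans ?_⟩
    simpa using (by exact_mod_cast hn : (q : K) ≤ ((n : ℚ) : K))
  · rintro ⟨n, hn⟩
    refine ⟨n + 1, by positivity, hn.trans ?_⟩
    simp

end FieldOrder

/-- An `ℝ`-place of a field `K`: a place `K → ℝ ∪ {∞}`. The elements with a finite value form a
valuation ring, on which the place is a ring homomorphism to `ℝ` whose kernel is the
maximal ideal. -/
@[ext]
structure RealPlace (K : Type*) [Field K] where
  toFun : K → OnePoint ℝ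
  map_one' : toFun 1 = ((1 : ℝ) : OnePoint ℝ)
  map_add' : ∀ (x y : K) (a b : ℝ), toFun x = (a : OnePoint ℝ) → toFun y = (b : OnePoint ℝ) →
    toFun (x + y) = ((a + b : ℝ) : OnePoint ℝ)
  map_mul' : ∀ (x y : K) (a b : ℝ), toFun x = (a : OnePoint ℝ) → toFun y = (b : OnePoint ℝ) →
    toFun (x * y) = ((a * b : ℝ) : OnePoint ℝ)
  map_inv' : ∀ x : K, toFun x = OnePoint.infty → toFun x⁻¹ = ((0 : ℝ) : OnePoint ℝ)

namespace FieldOrder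

open Classical in
/-- The function `K → ℝ ∪ {∞}` underlying the place of an order `P`. On `A(P)` it is the
composition of the residue map `A(P) → k(P) = A(P)/I(P)` with the unique order preserving embedding
of the Archimedean ordered field `k(P)` in `ℝ` (Mathlib's `ArchimedeanClass.stdPart`, for the
order of `K` given by `P`); outside `A(P)` its value is `∞`. -/
noncomputable def placeFun {K : Type*} [Field K] (P : RingPreordering K) [P.IsOrdering] (a : K) :
    OnePoint ℝ :=
  if a ∈ finiteElements P then
    ((@ArchimedeanClass.stdPart K (linearOrder P) _ (isOrderedRing P) a : ℝ) : OnePoint ℝ)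
  else OnePoint.infty

theorem placeFun_eq_coe_iff {K : Type*} [Field K] (P : RingPreordering K) [P.IsOrdering] (a : K)
    (r : ℝ) :
    placeFun P a = (r : OnePoint ℝ) ↔ a ∈ finiteElements P ∧
      @ArchimedeanClass.stdPart K (linearOrder P) _ (isOrderedRing P) a = r := by
  unfold placeFun
  split_ifs with h
  · simp [h]
  · simp [h]

/-- The canonical map `λ` from the orders to the `ℝ`-places of a field. -/
noncomputable def place {K : Type*} [Field K] (P : RingPreordering K) [P.IsOrdering] :
    RealPlace K where
  toFun := placeFun P
  map_one' := by
    let _ := linearOrder P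
    have : IsStrictOrderedRing K := isStrictOrderedRing P
    rw [placeFun_eq_coe_iff, mem_finiteElements_iff]
    exact ⟨(ArchimedeanClass.mk_one (R := K)).ge, ArchimedeanClass.stdPart_one⟩
  map_add' x y a b hx hy := by
    let _ := linearOrder P
    have : IsStrictOrderedRing K := isStrictOrderedRing P
    rw [placeFun_eq_coe_iff, mem_finiteElements_iff] at hx hy ⊢
    obtain ⟨hx, rfl⟩ := hx
    obtain ⟨hy, rfl⟩ := hy
    exact ⟨(le_min hx hy).trans (ArchimedeanClass.min_le_mk_add ..),
      ArchimedeanClass.stdPart_add hx hy⟩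
  map_mul' x y a b hx hy := by
    let _ := linearOrder P
    have : IsStrictOrderedRing K := isStrictOrderedRing P
    rw [placeFun_eq_coe_iff, mem_finiteElements_iff] at hx hy ⊢
    obtain ⟨hx, rfl⟩ := hx
    obtain ⟨hy, rfl⟩ := hy
    exact ⟨by rw [ArchimedeanClass.mk_mul]; exact add_nonneg hx hy,
      ArchimedeanClass.stdPart_mul hx hy⟩
  map_inv' x hx := by
    let _ := linearOrder P
    have : IsStrictOrderedRing K := isStrictOrderedRing P
    have hx' : ¬ 0 ≤ ArchimedeanClass.mk x := by
      rw [← mem_finiteElements_iff]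
      intro h
      simp [placeFun, h] at hx
    have hneg : ArchimedeanClass.mk x < 0 := not_le.1 hx'
    rw [placeFun_eq_coe_iff, mem_finiteElements_iff]
    constructor
    · by_contra hcon
      have hlt := not_le.1 hcon
      have h0 : x ≠ 0 := by
        rintro rfl
        simp at hx'
      have h1 : ArchimedeanClass.mk x + ArchimedeanClass.mk x⁻¹ = 0 := by
        rw [← ArchimedeanClass.mk_mul, mul_inv_cancel₀ h0, ArchimedeanClass.mk_one]
      have h2 := add_le_add hneg.le hlt.le
      have h3 : ArchimedeanClass.mk x + ArchimedeanClass.mk x⁻¹ ≤ ArchimedeanClass.mk x := by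
        simpa using add_le_add (le_refl (ArchimedeanClass.mk x)) hlt.le
      exact absurd (h1 ▸ h3) (not_le.2 hneg)
    · rw [ArchimedeanClass.stdPart_inv, ArchimedeanClass.stdPart_of_mk_ne_zero hneg.ne, inv_zero]

end FieldOrder

/-! ### Cuts of `R`

The natural valuation `v` of the ordered field `R` (with valuation ring `A(P)` for the given
order `P` of `R`) is `ArchimedeanClass.mk : R → ArchimedeanClass R`, written additively:
`v a ≤ v b` if and only if `|b| ≤ n * |a|` for some natural number `n`. Its value group `Γ` is the
set of elements of `ArchimedeanClass R` other than `⊤ = v 0`. -/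

namespace DedekindCut

/-- The lower part `A = {a ∈ R : a < X}` of the cut in `R` given by an order `P` of `R(X)`. -/
def lower {R : Type*} [Field R] (P : RingPreordering (RatFunc R)) : Set R :=
  {a | RatFunc.X - RatFunc.C a ∈ P}

/-- The upper part `B = {b ∈ R : X < b}` of the cut in `R` given by an order `P` of `R(X)`. -/
def upper {R : Type*} [Field R] (P : RingPreordering (RatFunc R)) : Set R :=
  {b | RatFunc.C b - RatFunc.X ∈ P}

/-- The lower cut `S = {v(b - a) : a ∈ A, b ∈ B}` in `Γ` determined by a cut `(A, B)`. -/
def valueCut {R : Type*} [Field R] [LinearOrder R] [IsStrictOrderedRing R] (A B : Set R) :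
    Set (ArchimedeanClass R) :=
  {γ | ∃ a ∈ A, ∃ b ∈ B, γ = ArchimedeanClass.mk (b - a)}

/-- The set `U = {v(a' - a) : a, a' ∈ B₁ ∩ A₂, a < a'}`, the distance between two cuts
`(A₁, B₁)` and `(A₂, B₂)` with `A₁ ⊆ A₂`. -/
def distanceCut {R : Type*} [Field R] [LinearOrder R] [IsStrictOrderedRing R] (B₁ A₂ : Set R) :
    Set (ArchimedeanClass R) :=
  {γ | ∃ a ∈ B₁ ∩ A₂, ∃ a' ∈ B₁ ∩ A₂, a < a' ∧ γ = ArchimedeanClass.mk (a' - a)}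

/-- A cut `(A, B)` is normal if it has neighbourhoods of arbitrarily small length. -/
def IsNormal {R : Type*} [Field R] [LinearOrder R] (A B : Set R) : Prop :=
  ∀ c : R, 0 < c → ∃ a ∈ A, ∃ b ∈ B, b - a < c

/-- A gap: a proper cut `(A, B)` such that `A` has no greatest and `B` no least element. -/
def IsGap {R : Type*} [LinearOrder R] (A B : Set R) : Prop :=
  A.Nonempty ∧ B.Nonempty ∧ (¬ ∃ a, IsGreatest A a) ∧ ¬ ∃ b, IsLeast B b

/-- An abnormal gap is a gap which is not normal. -/
def IsAbnormalGap {R : Type*} [Field R] [LinearOrder R] (A B : Set R) : Prop :=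
  IsGap A B ∧ ¬ IsNormal A B

end DedekindCut

/-! Why the theorem is true. Since `R` is real closed, irreducible polynomials over `R` have degree
at most two (`IsRealClosed.natDegree_le_two_of_irreducible`, proved by Galois theory as in the
algebraic proof of the fundamental theorem of algebra). Hence the sign of a polynomial for an order
of `R(X)` depends only on the cut of `X` in `R`, and an order is determined by its cut
(`FieldOrder.eq_of_lower_eq`).

Places are separated by linear functions. If `v (b - a)` with `a < X < b` lies in `S₁`, then
`(X - a) / (b - a)` is finite for `P₁`; it is finite for `P₂` only if `v (b - a)` lies in `S₂`
(`FieldOrder.valueCut_subset_of_place_eq`). If `a < a'` lie between the cuts and `v (a' - a)` lies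
in `S₁`, then `(X - a) / (a' - a)` has a value at most `0` at the first place and at least `1` at the
second, if it is finite there (`FieldOrder.place_ne_of_inter_distanceCut_nonempty`).

Conversely, suppose that `S₁ = S₂ = S`, that `S` is disjoint from `U` and that `a` lies between the
two cuts. For both orders the value of `y = X - a` then lies exactly in the cut `S` of the value
group: `|y| < c` if and only if `v c ∈ S`. As `R` contains roots of its positive elements, two
monomials `c * y ^ m` and `d * y ^ k` with `m ≠ k` have different values, and which one dominates
depends on `S` only. Therefore every polynomial in `y` is infinitely close, relative to its size, to
its dominant monomial, every rational function is so to a quotient of two monomials, and its value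
at the place is determined by `S` (`ArchimedeanClass.RealizesCut.exists_forall_placeValue_eq`).

For the classification, if one of the cuts is normal, then `S` contains all values of nonzero
elements, so only a single point fits between the cuts
(`FieldOrder.lower_upper_eq_of_forall_mem_valueCut`). A cut which is not normal is an abnormal gap
or improper.
-/

/-! ### Irreducible polynomials over a real closed field -/

namespace IsRealClosed

open Polynomial IntermediateField

/-- The elements `a + b * i` with `i ^ 2 = -1` and `a`, `b` in a real closed field have square
roots of the same form. -/
theorem exists_sq_eq_add_mul {R E : Type*} [Field R] [LinearOrder R] [IsStrictOrderedRing R]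
    [IsRealClosed R] [Field E] [Algebra R E] {i : E} (hi : i ^ 2 = -1) (a b : R) :
    ∃ u v : R, (algebraMap R E u + algebraMap R E v * i) ^ 2 =
      algebraMap R E a + algebraMap R E b * i := by
  obtain ⟨r, hr⟩ := exists_eq_pow_of_nonneg (x := a ^ 2 + b ^ 2) (by positivity) two_ne_zero
  wlog hr0 : 0 ≤ r generalizing r
  · exact this (-r) (by rw [hr]; ring) (by linarith)
  have har : |a| ≤ r := abs_le_of_sq_le_sq (by nlinarith [sq_nonneg b]) hr0
  obtain ⟨h1, h2⟩ := abs_le.1 har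
  obtain ⟨u, hu⟩ := exists_eq_pow_of_nonneg (x := (r + a) / 2) (by linarith) two_ne_zero
  obtain ⟨v, hv⟩ := exists_eq_pow_of_nonneg (x := (r - a) / 2) (by linarith) two_ne_zero
  have huv : (2 * u * v) ^ 2 = b ^ 2 := by
    calc (2 * u * v) ^ 2 = 4 * (u ^ 2 * v ^ 2) := by ring
      _ = b ^ 2 := by rw [← hu, ← hv]; linear_combination -hr
  have hsub : u ^ 2 - v ^ 2 = a := by rw [← hu, ← hv]; ring
  have key : ∀ w : R, u ^ 2 - w ^ 2 = a → 2 * u * w = b →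
      (algebraMap R E u + algebraMap R E w * i) ^ 2 = algebraMap R E a + algebraMap R E b * i := by
    intro w h1 h2
    rw [← h1, ← h2]
    simp only [map_sub, map_mul, map_pow, map_ofNat]
    linear_combination algebraMap R E w ^ 2 * hi
  rcases sq_eq_sq_iff_eq_or_eq_neg.1 huv with h | h
  · exact ⟨u, v, key v hsub h⟩
  · exact ⟨u, -v, key (-v) (by rw [neg_sq, hsub]) (by linear_combination -h)⟩

theorem mem_adjoin_sqrt_neg_one {R E : Type*} [Field R] [LinearOrder R] [IsStrictOrderedRing R]
    [Field E] [Algebra R E] {i : E} (hi : i ^ 2 = -1) {x : E} (hx : x ∈ R⟮i⟯) :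
    ∃ a b : R, x = algebraMap R E a + algebraMap R E b * i := by
  induction hx using IntermediateField.adjoin_induction with
  | mem x hx => exact ⟨0, 1, by simp_all⟩
  | algebraMap x => exact ⟨x, 0, by simp⟩
  | add x y _ _ hx hy =>
    obtain ⟨a, b, rfl⟩ := hx
    obtain ⟨c, d, rfl⟩ := hy
    exact ⟨a + c, b + d, by simp only [map_add]; ring⟩
  | mul x y _ _ hx hy =>
    obtain ⟨a, b, rfl⟩ := hx
    obtain ⟨c, d, rfl⟩ := hy
    refine ⟨a * c - b * d, a * d + b * c, ?_⟩
    simp only [map_add, map_sub, map_mul]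
    linear_combination algebraMap R E b * algebraMap R E d * hi
  | inv x _ hx =>
    obtain ⟨a, b, rfl⟩ := hx
    by_cases h0 : a ^ 2 + b ^ 2 = 0
    · obtain ⟨rfl, rfl⟩ : a = 0 ∧ b = 0 := by
        constructor <;> nlinarith [sq_nonneg a, sq_nonneg b]
      exact ⟨0, 0, by simp⟩
    · refine ⟨a / (a ^ 2 + b ^ 2), -b / (a ^ 2 + b ^ 2), ?_⟩
      have h0' : algebraMap R E a ^ 2 + algebraMap R E b ^ 2 ≠ 0 := by
        rw [← map_pow, ← map_pow, ← map_add]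
        exact (_root_.map_ne_zero _).2 h0
      apply inv_eq_of_mul_eq_one_right
      simp only [map_div₀, map_add, map_neg, map_pow]
      field_simp
      linear_combination -algebraMap R E b ^ 2 * hi

theorem finrank_eq_one_of_odd {R E : Type*} [Field R] [IsRealClosed R] [Field E] [Algebra R E]
    [FiniteDimensional R E] (h : Odd (Module.finrank R E)) : Module.finrank R E = 1 := by
  obtain ⟨α, hα⟩ := Field.exists_primitive_element R E
  have hint : IsIntegral R α := Algebra.IsIntegral.isIntegral α
  have hdeg : (minpoly R α).natDegree = Module.finrank R E := by
    rw [← adjoin.finrank hint, hα, finrank_top']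
  obtain ⟨x, hx⟩ := exists_isRoot_of_odd_natDegree (f := minpoly R α) (by rwa [hdeg])
  rw [← hdeg]
  exact natDegree_eq_of_degree_eq_some
    (degree_eq_one_of_irreducible_of_root (minpoly.irreducible hint) hx)

theorem finrank_ne_two_of_forall_isSquare {M F : Type*} [Field M] [CharZero M] [Field F]
    [Algebra M F] (hsq : ∀ x : M, IsSquare x) : Module.finrank M F ≠ 2 := by
  intro h
  have : FiniteDimensional M F := .of_finrank_pos (by omega)
  obtain ⟨α, hα⟩ := Field.exists_primitive_element M F
  have hint : IsIntegral M α := Algebra.IsIntegral.isIntegral α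
  have hdeg : (minpoly M α).natDegree = 2 := by
    rw [← adjoin.finrank hint, hα, finrank_top', h]
  have hirr := minpoly.irreducible hint
  have hmonic := minpoly.monic hint
  obtain ⟨s, hs⟩ := hsq ((minpoly M α).coeff 1 ^ 2 - 4 * (minpoly M α).coeff 0)
  have h2 : (minpoly M α).coeff 2 = 1 := by rw [← hdeg]; exact hmonic
  have hroot : (minpoly M α).IsRoot ((s - (minpoly M α).coeff 1) / 2) := by
    rw [IsRoot.def, eval_eq_sum_range, hdeg]
    simp only [Finset.sum_range_succ, Finset.range_zero, Finset.sum_empty, h2]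
    field_simp
    linear_combination -hs
  have h1 := natDegree_eq_of_degree_eq_some (degree_eq_one_of_irreducible_of_root hirr hroot)
  rw [hdeg] at h1
  exact absurd h1 (by norm_num)

/-- Let `E` be a finite Galois extension of a real closed field `R` containing a square root of
`-1`. The fixed field of a Sylow `2`-subgroup has odd degree over `R`, hence is `R`, so the Galois
group is a `2`-group. If `E` were larger than `R(i)`, a subgroup of index two of the Galois group
over `R(i)` would give a quadratic extension of `R(i)`, in which all elements are squares. -/
theorem finrank_le_two_of_isGalois {R E : Type*} [Field R] [LinearOrder R] [IsStrictOrderedRing R]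
    [IsRealClosed R] [Field E] [Algebra R E] [FiniteDimensional R E] [IsGalois R E] {i : E}
    (hi : i ^ 2 = -1) : Module.finrank R E ≤ 2 := by
  have : Fact (Nat.Prime 2) := ⟨Nat.prime_two⟩
  have h2pow : ∃ n, Module.finrank R E = 2 ^ n := by
    obtain ⟨H⟩ : Nonempty (Sylow 2 Gal(E/R)) := inferInstance
    obtain ⟨n, hn⟩ := IsPGroup.iff_card.1 H.isPGroup'
    have h1 : Module.finrank (fixedField (H : Subgroup Gal(E/R))) E = 2 ^ n := by
      rw [finrank_fixedField_eq_card, hn]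
    have h2 := Module.finrank_mul_finrank R (fixedField (H : Subgroup Gal(E/R))) E
    have h3 := (H : Subgroup Gal(E/R)).card_mul_index
    rw [IsGalois.card_aut_eq_finrank, hn] at h3
    have h4 : Module.finrank R (fixedField (H : Subgroup Gal(E/R))) =
        (H : Subgroup Gal(E/R)).index := by
      rw [h1, ← h3, mul_comm] at h2
      exact Nat.eq_of_mul_eq_mul_left (by positivity) h2
    have h5 : Odd (Module.finrank R (fixedField (H : Subgroup Gal(E/R)))) := by
      rw [h4, ← Nat.not_even_iff_odd, even_iff_two_dvd]
      exact H.not_dvd_index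
    rw [finrank_eq_one_of_odd h5, one_mul, h1] at h2
    exact ⟨n, h2.symm⟩
  obtain ⟨n, hn⟩ := h2pow
  have hchar : CharZero R := inferInstance
  have hM : Module.finrank R R⟮i⟯ ≤ 2 := by
    have hint : IsIntegral R i := Algebra.IsIntegral.isIntegral i
    rw [adjoin.finrank hint]
    have hdvd : minpoly R i ∣ X ^ 2 + 1 := minpoly.dvd R i (by simp [hi])
    have hne : (X ^ 2 + 1 : R[X]).natDegree = 2 := by compute_degree!
    rw [← hne]
    exact natDegree_le_of_dvd hdvd (fun h => by simp [h] at hne)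
  have htower := Module.finrank_mul_finrank R R⟮i⟯ E
  suffices Module.finrank R⟮i⟯ E = 1 by rw [← htower, this]; omega
  rw [hn] at htower
  obtain ⟨j, -, hj⟩ := (Nat.dvd_prime_pow Nat.prime_two).1 (Dvd.intro_left _ htower)
  rcases j with _ | j
  · simpa using hj
  exfalso
  have hcard : 2 ^ j ∣ Nat.card Gal(E/R⟮i⟯) := by
    rw [IsGalois.card_aut_eq_finrank, hj]
    exact pow_dvd_pow _ (Nat.le_succ _)
  obtain ⟨N, hN⟩ := Sylow.exists_subgroup_card_pow_prime 2 hcard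
  have hF := Module.finrank_mul_finrank R⟮i⟯ (fixedField N) E
  rw [finrank_fixedField_eq_card, hN, hj, pow_succ, mul_comm] at hF
  have hchar' : CharZero R⟮i⟯ := charZero_of_injective_algebraMap (algebraMap R R⟮i⟯).injective
  refine finrank_ne_two_of_forall_isSquare (M := R⟮i⟯) (F := fixedField N) (fun x => ?_)
    (Nat.eq_of_mul_eq_mul_left (by positivity) hF)
  obtain ⟨a, b, hab⟩ := mem_adjoin_sqrt_neg_one hi x.2
  obtain ⟨u, v, huv⟩ := exists_sq_eq_add_mul hi a b
  refine ⟨algebraMap R R⟮i⟯ u + algebraMap R R⟮i⟯ v * AdjoinSimple.gen R i, Subtype.ext ?_⟩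
  rw [hab, ← huv, sq]
  rfl

theorem natDegree_le_two_of_irreducible {R : Type*} [Field R] [LinearOrder R]
    [IsStrictOrderedRing R] [IsRealClosed R] {f : R[X]} (hf : Irreducible f) :
    f.natDegree ≤ 2 := by
  let g : R[X] := f * (X ^ 2 + 1)
  have hX : (X ^ 2 + 1 : R[X]).natDegree = 2 := by compute_degree!
  have hX0 : (X ^ 2 + 1 : R[X]) ≠ 0 := fun h => by simp [h] at hX
  have hg0 : g ≠ 0 := mul_ne_zero hf.ne_zero hX0
  have hchar : CharZero R := inferInstance
  let E := g.SplittingField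
  have : Normal R E := Normal.of_isSplittingField g
  have : IsGalois R E := {}
  have hsplit : (g.map (algebraMap R E)).Splits := SplittingField.splits g
  have hroot : ∀ q : R[X], q ∣ g → q.natDegree ≠ 0 → ∃ x : E, aeval x q = 0 := by
    intro q hq hd
    have hs : (q.map (algebraMap R E)).Splits :=
      hsplit.of_dvd (by simpa using hg0) (Polynomial.map_dvd _ hq)
    obtain ⟨x, hx⟩ := hs.exists_eval_eq_zero (by
      rw [degree_map]
      exact fun h => hd (natDegree_eq_of_degree_eq_some h))
    exact ⟨x, by rwa [aeval_def, eval₂_eq_eval_map]⟩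
  obtain ⟨i, hi⟩ := hroot (X ^ 2 + 1) (dvd_mul_left _ _) (by rw [hX]; norm_num)
  obtain ⟨x, hx⟩ := hroot f (dvd_mul_right _ _) hf.natDegree_pos.ne'
  have hE : Module.finrank R E ≤ 2 :=
    finrank_le_two_of_isGalois (i := i) (eq_neg_of_add_eq_zero_left (by simpa using hi))
  have hint : IsIntegral R x := Algebra.IsIntegral.isIntegral x
  have hdvd : f ∣ minpoly R x :=
    ((minpoly.irreducible hint).associated_of_dvd hf (minpoly.dvd R x hx)).symm.dvd
  calc f.natDegree ≤ (minpoly R x).natDegree := natDegree_le_of_dvd hdvd (minpoly.ne_zero hint)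
    _ ≤ Module.finrank R E := minpoly.natDegree_le x
    _ ≤ 2 := hE

end IsRealClosed

/-! ### Standard parts in ordered fields -/

namespace ArchimedeanClass

theorem mk_mul_lt_mk_mul {K : Type*} [Field K] [LinearOrder K] [IsStrictOrderedRing K]
    {a b c : K} (hc : c ≠ 0) (h : mk a < mk b) : mk (a * c) < mk (b * c) := by
  rw [mk_lt_mk] at h ⊢
  intro n
  rw [abs_mul, abs_mul, ← smul_mul_assoc]
  exact mul_lt_mul_of_pos_right (h n) (abs_pos.2 hc)

theorem mk_map_le_mk_map {R K : Type*} [Field R] [LinearOrder R] [IsStrictOrderedRing R]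
    [Field K] [LinearOrder K] [IsStrictOrderedRing K] (f : R →+*o K) {x y : R} :
    mk (f x) ≤ mk (f y) ↔ mk x ≤ mk y := by
  have hf : StrictMono f := f.monotone'.strictMono_of_injective f.toRingHom.injective
  rw [mk_le_mk, mk_le_mk]
  refine exists_congr fun n => ?_
  have h : ∀ z : R, |f z| = f |z| := fun z => (map_abs f z).symm
  rw [h, h, ← map_nsmul, hf.le_iff_le]

theorem stdPart_map {R K : Type*} [Field R] [LinearOrder R] [IsStrictOrderedRing R]
    [Field K] [LinearOrder K] [IsStrictOrderedRing K] (f : R →+*o K) {x : R} (hx : 0 ≤ mk x) :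
    stdPart (f x) = stdPart x := by
  have hfx : 0 ≤ mk (f x) := by
    rw [← mk_one, ← map_one f, mk_map_le_mk_map]
    simpa using hx
  -- A rational number strictly on one side of `stdPart x` is on the same side of `x`, and its image
  -- is on the same side of `f x`.
  apply le_antisymm
  · by_contra! h
    obtain ⟨q, hq1, hq2⟩ := exists_rat_btwn h
    have hxq : x ≤ q := by
      by_contra! hc
      have := stdPart_monotoneOn (mk_ratCast_nonneg q) hx hc.le
      rw [stdPart_ratCast] at this
      exact absurd hq1 this.not_gt
    have h1 : f x ≤ q := by simpa using f.monotone' hxq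
    have := stdPart_monotoneOn hfx (mk_ratCast_nonneg q) h1
    rw [stdPart_ratCast] at this
    exact absurd hq2 this.not_gt
  · by_contra! h
    obtain ⟨q, hq1, hq2⟩ := exists_rat_btwn h
    have hxq : (q : R) ≤ x := by
      by_contra! hc
      have := stdPart_monotoneOn hx (mk_ratCast_nonneg q) hc.le
      rw [stdPart_ratCast] at this
      exact absurd hq2 this.not_gt
    have h1 : q ≤ f x := by simpa using f.monotone' hxq
    have := stdPart_monotoneOn (mk_ratCast_nonneg q) hfx h1
    rw [stdPart_ratCast] at this
    exact absurd hq1 this.not_gt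

/-- The hypothesis `mk g < mk (f - g)` says that `f / g - 1` is infinitesimal. This relation between
`f` and `g` is compatible with division. -/
theorem mk_div_lt_mk_div_sub_div {K : Type*} [Field K] [LinearOrder K] [IsStrictOrderedRing K]
    {f g f' g' : K} (h : mk g < mk (f - g)) (h' : mk g' < mk (f' - g')) :
    mk (g / g') < mk (f / f' - g / g') := by
  have hg : g ≠ 0 := by rintro rfl; simp at h
  have hg' : g' ≠ 0 := by rintro rfl; simp at h'
  have hf : mk f' = mk g' := by
    have := mk_add_eq_mk_left h'
    rwa [add_sub_cancel] at this
  have hf' : f' ≠ 0 := by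
    intro h0
    rw [h0, mk_zero, eq_comm, mk_eq_top_iff] at hf
    exact hg' hf
  have h1 : f / f' - g / g' = ((f - g) * g' - (f' - g') * g) * (g'⁻¹ * f'⁻¹) := by
    field_simp
    ring
  have h2 : mk (g / g') = mk ((g * g') * (g'⁻¹ * f'⁻¹)) := by
    simp only [mk_div, mk_mul, mk_inv, hf, sub_eq_add_neg]
    rw [add_assoc, ← add_assoc (mk g'), LinearOrderedAddCommGroupWithTop.add_neg_cancel_of_ne_top,
      zero_add]
    simpa using hg'
  rw [h1, h2]
  refine mk_mul_lt_mk_mul (mul_ne_zero (inv_ne_zero hg') (inv_ne_zero hf')) ?_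
  refine lt_of_lt_of_le (lt_min (mk_mul_lt_mk_mul hg' h) ?_) (min_le_mk_sub _ _)
  rw [mul_comm g]
  exact mk_mul_lt_mk_mul hg h'

end ArchimedeanClass

/-! ### Orders of the rational function field and their cuts -/

namespace FieldOrder

variable {R : Type*} [Field R] [LinearOrder R] [IsStrictOrderedRing R] [IsRealClosed R]

theorem C_mem_iff (P : RingPreordering (RatFunc R)) {c : R} :
    RatFunc.C c ∈ P ↔ 0 ≤ c := by
  have h : ∀ {d : R}, 0 ≤ d → RatFunc.C d ∈ P := fun hd => by
    obtain ⟨e, rfl⟩ := IsRealClosed.nonneg_iff_isSquare.1 hd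
    rw [map_mul]
    exact RingPreordering.mul_self_mem P _
  refine ⟨fun hc => ?_, h⟩
  by_contra! hneg
  have h0 := RingPreordering.eq_zero_of_mem_of_neg_mem hc
    (by rw [← map_neg]; exact h (neg_nonneg.2 hneg.le))
  exact hneg.ne (by simpa using h0)

theorem C_sub_C_mem_iff (P : RingPreordering (RatFunc R)) {a b : R} :
    RatFunc.C b - RatFunc.C a ∈ P ↔ a ≤ b := by
  rw [← map_sub, C_mem_iff, sub_nonneg]

omit [LinearOrder R] [IsStrictOrderedRing R] [IsRealClosed R] in
theorem X_sub_C_ne_zero (a : R) : (RatFunc.X - RatFunc.C a : RatFunc R) ≠ 0 := by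
  rw [← RatFunc.algebraMap_X, ← RatFunc.algebraMap_C, ← map_sub]
  exact (map_ne_zero_iff _ (RatFunc.algebraMap_injective R)).2 (Polynomial.X_sub_C_ne_zero a)

omit [LinearOrder R] [IsStrictOrderedRing R] [IsRealClosed R] in
theorem mem_upper_iff_notMem_lower (P : RingPreordering (RatFunc R)) [P.IsOrdering] {a : R} :
    a ∈ DedekindCut.upper P ↔ a ∉ DedekindCut.lower P := by
  change RatFunc.C a - RatFunc.X ∈ P ↔ ¬ RatFunc.X - RatFunc.C a ∈ P
  refine ⟨fun h h' => X_sub_C_ne_zero a ?_, fun h => ?_⟩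
  · exact RingPreordering.eq_zero_of_mem_of_neg_mem h' (by rwa [neg_sub])
  · rw [← neg_sub]
    exact (mem_or_neg_mem P _).resolve_left h

theorem mem_lower_of_le {P : RingPreordering (RatFunc R)} {a b : R}
    (hb : b ∈ DedekindCut.lower P) (hab : a ≤ b) : a ∈ DedekindCut.lower P := by
  have h : RatFunc.X - RatFunc.C b + (RatFunc.C b - RatFunc.C a) ∈ P :=
    add_mem hb ((C_sub_C_mem_iff P).2 hab)
  rwa [sub_add_sub_cancel] at h

theorem mem_upper_of_le {P : RingPreordering (RatFunc R)} {a b : R}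
    (ha : a ∈ DedekindCut.upper P) (hab : a ≤ b) : b ∈ DedekindCut.upper P := by
  have h : RatFunc.C b - RatFunc.C a + (RatFunc.C a - RatFunc.X) ∈ P :=
    add_mem ((C_sub_C_mem_iff P).2 hab) ha
  rwa [sub_add_sub_cancel] at h

theorem lt_of_mem_lower_of_mem_upper {P : RingPreordering (RatFunc R)} [P.IsOrdering] {a b : R}
    (ha : a ∈ DedekindCut.lower P) (hb : b ∈ DedekindCut.upper P) : a < b := by
  by_contra! h
  exact (mem_upper_iff_notMem_lower P).1 hb (mem_lower_of_le ha h)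

theorem mul_mem_iff_mul_mem {K : Type*} [Field K] (P₁ P₂ : RingPreordering K) [P₁.IsOrdering]
    [P₂.IsOrdering] {x y : K} (hx0 : x ≠ 0) (hy0 : y ≠ 0) (hx : x ∈ P₁ ↔ x ∈ P₂)
    (hy : y ∈ P₁ ↔ y ∈ P₂) : x * y ∈ P₁ ↔ x * y ∈ P₂ := by
  have sign : ∀ (P : RingPreordering K) [P.IsOrdering],
      x * y ∈ P ↔ (x ∈ P ↔ y ∈ P) := by
    intro P _
    let _ := linearOrder P
    have : IsStrictOrderedRing K := isStrictOrderedRing P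
    have h : ∀ z : K, z ∈ P ↔ 0 ≤ z := fun z => by
      change _ ↔ z - 0 ∈ P
      rw [sub_zero]
    rw [h, h, h]
    rcases hx0.lt_or_gt with hx | hx <;> rcases hy0.lt_or_gt with hy | hy
    · simp [hx.not_ge, hy.not_ge, (mul_pos_of_neg_of_neg hx hy).le]
    · simp [hx.not_ge, hy.le, (mul_neg_of_neg_of_pos hx hy)]
    · simp [hx.le, hy.not_ge, (mul_neg_of_pos_of_neg hx hy)]
    · simp [hx.le, hy.le, (mul_pos hx hy).le]
  rw [sign, sign, hx, hy]

open Polynomial in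
/-- An order of `R(X)` is determined by its cut. Every polynomial is a product of linear factors,
whose signs are given by the cut, and of irreducible quadratic polynomials, whose sign is that of
the leading coefficient by completion of the square. -/
theorem eq_of_lower_eq (P₁ P₂ : RingPreordering (RatFunc R)) [P₁.IsOrdering]
    [P₂.IsOrdering] (h : DedekindCut.lower P₁ = DedekindCut.lower P₂) : P₁ = P₂ := by
  have hinj := RatFunc.algebraMap_injective R
  have hne : ∀ {p : R[X]}, p ≠ 0 → algebraMap R[X] (RatFunc R) p ≠ 0 :=
    fun hp => (map_ne_zero_iff _ hinj).2 hp
  have hC : ∀ c : R, RatFunc.C c ∈ P₁ ↔ RatFunc.C c ∈ P₂ := fun c => by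
    rw [C_mem_iff, C_mem_iff]
  have hC0 : ∀ {c : R}, c ≠ 0 → (RatFunc.C c : RatFunc R) ≠ 0 := fun hc =>
    (map_ne_zero_iff _ RatFunc.C_injective).2 hc
  have hirr : ∀ p : R[X], Irreducible p →
      (algebraMap R[X] (RatFunc R) p ∈ P₁ ↔ algebraMap R[X] (RatFunc R) p ∈ P₂) := by
    intro p hp
    have hdeg := IsRealClosed.natDegree_le_two_of_irreducible hp
    have hpos := hp.natDegree_pos
    obtain hd | hd : p.natDegree = 1 ∨ p.natDegree = 2 := by omega
    · obtain ⟨a, ha, b, rfl⟩ := natDegree_eq_one.1 hd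
      have hrw : algebraMap R[X] (RatFunc R) (C a * X + C b) =
          RatFunc.C a * (RatFunc.X - RatFunc.C (-(b / a))) := by
        simp only [map_add, map_mul, RatFunc.algebraMap_C, RatFunc.algebraMap_X, map_neg, map_div₀]
        have := hC0 ha
        field_simp
        ring
      rw [hrw]
      exact mul_mem_iff_mul_mem P₁ P₂ (hC0 ha) (X_sub_C_ne_zero _) (hC a)
        (Set.ext_iff.1 h (-(b / a)))
    · obtain ⟨a, b, c, rfl⟩ : ∃ a b c : R, p = C a * X ^ 2 + C b * X + C c :=
        ⟨_, _, _, eq_quadratic_of_degree_le_two (natDegree_le_iff_degree_le.1 hdeg)⟩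
      have ha : a ≠ 0 := by
        rintro rfl
        have : (C 0 * X ^ 2 + C b * X + C c : R[X]).natDegree ≤ 1 := by
          rw [C_0, zero_mul, zero_add]
          exact natDegree_linear_le
        omega
      -- An irreducible quadratic polynomial has a negative discriminant.
      have hdisc : b ^ 2 - 4 * a * c < 0 := by
        by_contra! hge
        obtain ⟨s, hs⟩ := IsRealClosed.nonneg_iff_isSquare.1 hge
        have hroot : (C a * X ^ 2 + C b * X + C c).IsRoot ((s - b) / (2 * a)) := by
          simp only [IsRoot.def, eval_add, eval_mul, eval_C, eval_pow, eval_X]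
          field_simp
          linear_combination -hs
        have := natDegree_eq_of_degree_eq_some (degree_eq_one_of_irreducible_of_root hp hroot)
        rw [hd] at this
        exact absurd this (by norm_num)
      have hprod : ∀ P : RingPreordering (RatFunc R), RatFunc.C (4 * a) *
          algebraMap R[X] (RatFunc R) (C a * X ^ 2 + C b * X + C c) ∈ P := by
        intro P
        have hrw : RatFunc.C (4 * a) * algebraMap R[X] (RatFunc R) (C a * X ^ 2 + C b * X + C c) =
            (RatFunc.C (2 * a) * RatFunc.X + RatFunc.C b) ^ 2 +
              RatFunc.C (4 * a * c - b ^ 2) := by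
          simp only [map_add, map_sub, map_mul, map_pow, RatFunc.algebraMap_C,
            RatFunc.algebraMap_X, map_ofNat]
          ring
        rw [hrw]
        exact add_mem (RingPreordering.pow_two_mem P _) ((C_mem_iff P).2 (by linarith))
      have h4a : 4 * a ≠ 0 := mul_ne_zero (by norm_num) ha
      have := mul_mem_iff_mul_mem P₁ P₂ (inv_ne_zero (hC0 h4a))
        (mul_ne_zero (hC0 h4a) (hne hp.ne_zero)) (by rw [← map_inv₀]; exact hC _)
        (iff_of_true (hprod P₁) (hprod P₂))
      rwa [inv_mul_cancel_left₀ (hC0 h4a)] at this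
  have hpoly : ∀ p : R[X],
      (algebraMap R[X] (RatFunc R) p ∈ P₁ ↔ algebraMap R[X] (RatFunc R) p ∈ P₂) := by
    intro p
    induction p using WfDvdMonoid.induction_on_irreducible with
    | zero => simp
    | unit u hu =>
      obtain ⟨c, -, rfl⟩ := isUnit_iff.1 hu
      rw [RatFunc.algebraMap_C]
      exact hC c
    | mul p q hp hq ih =>
      rw [map_mul]
      exact mul_mem_iff_mul_mem P₁ P₂ (hne hq.ne_zero) (hne hp) (hirr q hq) ih
  refine SetLike.ext fun f => ?_
  by_cases hf : f = 0
  · simp [hf]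
  -- The quotient `p / q` has the sign of `p * q`.
  have hd := hne (RatFunc.denom_ne_zero f)
  have hfrac : f = algebraMap R[X] (RatFunc R) (f.num * f.denom) *
      (algebraMap R[X] (RatFunc R) f.denom ^ 2)⁻¹ := by
    conv_lhs => rw [← RatFunc.num_div_denom f]
    rw [map_mul]
    field_simp
  have hsq : ∀ P : RingPreordering (RatFunc R),
      (algebraMap R[X] (RatFunc R) f.denom ^ 2)⁻¹ ∈ P := fun P => by
    rw [← inv_pow]
    exact RingPreordering.pow_two_mem P _
  rw [hfrac]
  exact mul_mem_iff_mul_mem P₁ P₂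
    (hne (mul_ne_zero (RatFunc.num_ne_zero hf) (RatFunc.denom_ne_zero f)))
    (inv_ne_zero (pow_ne_zero _ hd)) (hpoly _) (iff_of_true (hsq P₁) (hsq P₂))

end FieldOrder

/-! ### Separating places -/

namespace FieldOrder

theorem placeFun_eq_of_place_eq {K : Type*} [Field K] {P₁ P₂ : RingPreordering K}
    [P₁.IsOrdering] [P₂.IsOrdering] (h : place P₁ = place P₂) (f : K) :
    placeFun P₁ f = placeFun P₂ f :=
  congrFun (congrArg RealPlace.toFun h) f

theorem mem_finiteElements_of_place_eq {K : Type*} [Field K] {P₁ P₂ : RingPreordering K}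
    [P₁.IsOrdering] [P₂.IsOrdering] (h : place P₁ = place P₂) {f : K}
    (hf : f ∈ finiteElements P₁) : f ∈ finiteElements P₂ := by
  have h1 := (placeFun_eq_coe_iff P₁ f _).2 ⟨hf, rfl⟩
  rw [placeFun_eq_of_place_eq h] at h1
  exact ((placeFun_eq_coe_iff P₂ f _).1 h1).1

theorem exists_placeFun_eq_nonpos {K : Type*} [Field K] {P : RingPreordering K} [P.IsOrdering]
    {f : K} (hf : f ∈ finiteElements P) (h : -f ∈ P) :
    ∃ r : ℝ, r ≤ 0 ∧ placeFun P f = (r : OnePoint ℝ) := by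
  let _ := linearOrder P
  have : IsStrictOrderedRing K := isStrictOrderedRing P
  have hf0 : f ≤ 0 := by
    change 0 - f ∈ P
    rwa [zero_sub]
  exact ⟨_, ArchimedeanClass.stdPart_nonpos hf0, (placeFun_eq_coe_iff P f _).2 ⟨hf, rfl⟩⟩

theorem exists_placeFun_eq_one_le {K : Type*} [Field K] {P : RingPreordering K} [P.IsOrdering]
    {f : K} (hf : f ∈ finiteElements P) (h : f - 1 ∈ P) :
    ∃ r : ℝ, 1 ≤ r ∧ placeFun P f = (r : OnePoint ℝ) := by
  let _ := linearOrder P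
  have : IsStrictOrderedRing K := isStrictOrderedRing P
  refine ⟨_, ?_, (placeFun_eq_coe_iff P f _).2 ⟨hf, rfl⟩⟩
  have h1 := ArchimedeanClass.stdPart_monotoneOn (K := K) (by simp)
    ((mem_finiteElements_iff P f).1 hf) (show (1 : K) ≤ f from h)
  rwa [ArchimedeanClass.stdPart_one] at h1

variable {R : Type*} [Field R] [LinearOrder R] [IsStrictOrderedRing R] [IsRealClosed R]

theorem mul_C_mem_iff (P : RingPreordering (RatFunc R)) {d : R} (hd : 0 < d) {f : RatFunc R} :
    f * RatFunc.C d ∈ P ↔ f ∈ P := by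
  have hd0 : (RatFunc.C d : RatFunc R) ≠ 0 := (map_ne_zero_iff _ RatFunc.C_injective).2 hd.ne'
  refine ⟨fun h => ?_, fun h => mul_mem h ((C_mem_iff P).2 hd.le)⟩
  have := mul_mem h ((C_mem_iff P).2 (inv_pos.2 hd).le)
  rwa [map_inv₀, mul_inv_cancel_right₀ hd0] at this

/-- For `d > 0`, the element `(X - a) / d` is finite if and only if `X` lies between `a - q * d`
and `a + q * d` for some rational number `q`. -/
theorem div_mem_finiteElements_iff (P : RingPreordering (RatFunc R)) {a d : R} (hd : 0 < d) :
    (RatFunc.X - RatFunc.C a) / RatFunc.C d ∈ finiteElements P ↔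
      ∃ q : ℚ, 0 < q ∧ a - q * d ∈ DedekindCut.lower P ∧ a + q * d ∈ DedekindCut.upper P := by
  have hd0 : (RatFunc.C d : RatFunc R) ≠ 0 := (map_ne_zero_iff _ RatFunc.C_injective).2 hd.ne'
  refine exists_congr fun q => and_congr_right fun _ => ?_
  rw [← mul_C_mem_iff P hd, ← mul_C_mem_iff P (f := (q : RatFunc R) - _) hd, add_mul, sub_mul,
    div_mul_cancel₀ _ hd0]
  change _ ↔ RatFunc.X - RatFunc.C (a - q * d) ∈ P ∧ RatFunc.C (a + q * d) - RatFunc.X ∈ P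
  rw [map_sub, map_add, map_mul, map_ratCast]
  exact and_congr (iff_of_eq (congrArg (· ∈ P) (by ring))) (iff_of_eq (congrArg (· ∈ P) (by ring)))

/-- If `a < X < b` for the first order, then `(X - a) / (b - a)` is finite for it. If it is
finite for the second order, then `X` lies in an interval of length comparable to `b - a`. -/
theorem valueCut_subset_of_place_eq {P₁ P₂ : RingPreordering (RatFunc R)} [P₁.IsOrdering]
    [P₂.IsOrdering] (h : place P₁ = place P₂) :
    DedekindCut.valueCut (DedekindCut.lower P₁) (DedekindCut.upper P₁) ⊆
      DedekindCut.valueCut (DedekindCut.lower P₂) (DedekindCut.upper P₂) := by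
  rintro _ ⟨a, ha, b, hb, rfl⟩
  have hd : 0 < b - a := sub_pos.2 (lt_of_mem_lower_of_mem_upper ha hb)
  have hfin := (div_mem_finiteElements_iff P₁ (a := a) hd).2
    ⟨1, one_pos, mem_lower_of_le ha (by simpa using hd.le), by simpa using hb⟩
  obtain ⟨q, hq, h1, h2⟩ :=
    (div_mem_finiteElements_iff P₂ hd).1 (mem_finiteElements_of_place_eq h hfin)
  refine ⟨_, h1, _, h2, ?_⟩
  have : a + q * (b - a) - (a - q * (b - a)) = ((2 * q : ℚ) : R) * (b - a) := by
    push_cast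
    ring
  rw [this, ArchimedeanClass.mk_mul, ArchimedeanClass.mk_ratCast (by positivity), zero_add]

/-- If `a < a'` lie between the two cuts and `a' - a` is comparable to the length of an interval
containing `X` for the first order, then `(X - a) / (a' - a)` is finite, and the places separate it:
its value is at most `0` for the first order and at least `1` for the second. -/
theorem place_ne_of_inter_distanceCut_nonempty {P₁ P₂ : RingPreordering (RatFunc R)}
    [P₁.IsOrdering] [P₂.IsOrdering]
    (h : (DedekindCut.valueCut (DedekindCut.lower P₁) (DedekindCut.upper P₁) ∩
      DedekindCut.distanceCut (DedekindCut.upper P₁) (DedekindCut.lower P₂)).Nonempty) :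
    place P₁ ≠ place P₂ := by
  rintro hP
  obtain ⟨γ, ⟨a₁, ha₁, b₁, hb₁, rfl⟩, a, ⟨ha, ha2⟩, a', ⟨ha', ha2'⟩, haa', hγ⟩ := h
  have hd : 0 < a' - a := sub_pos.2 haa'
  have hd0 : (RatFunc.C (a' - a) : RatFunc R) ≠ 0 :=
    (map_ne_zero_iff _ RatFunc.C_injective).2 hd.ne'
  have hb0 : 0 < b₁ - a₁ := sub_pos.2 (lt_of_mem_lower_of_mem_upper ha₁ hb₁)
  have ha0 : a₁ < a := lt_of_mem_lower_of_mem_upper ha₁ ha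
  -- First, `(X - a₁) / (a' - a)` is finite for the first order, hence for the second.
  have hfin₁ : (RatFunc.X - RatFunc.C a₁) / RatFunc.C (a' - a) ∈ finiteElements P₁ := by
    obtain ⟨n, hn⟩ := ArchimedeanClass.mk_le_mk.1 hγ.ge
    rw [abs_of_pos hb0, abs_of_pos hd, nsmul_eq_mul] at hn
    refine (div_mem_finiteElements_iff P₁ hd).2 ⟨n + 1, by positivity,
      mem_lower_of_le ha₁ ?_, mem_upper_of_le hb₁ ?_⟩
    · push_cast
      nlinarith [(Nat.cast_nonneg n : (0 : R) ≤ n)]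
    · push_cast
      nlinarith
  obtain ⟨q, hq, -, hq2⟩ := (div_mem_finiteElements_iff P₂ hd).1
    (mem_finiteElements_of_place_eq hP hfin₁)
  -- Since `a < X` for the second order, `a - a₁` is at most a rational multiple of `a' - a`.
  have haq : a < a₁ + q * (a' - a) := lt_of_mem_lower_of_mem_upper ha2 hq2
  have hfin : (RatFunc.X - RatFunc.C a) / RatFunc.C (a' - a) ∈ finiteElements P₁ := by
    refine (div_mem_finiteElements_iff P₁ hd).2 ⟨q, hq, mem_lower_of_le ha₁ (by linarith),
      mem_upper_of_le ha ?_⟩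
    have : (0 : R) < q := by exact_mod_cast hq
    nlinarith
  obtain ⟨r, hr, hr'⟩ := exists_placeFun_eq_nonpos hfin (by
    rw [← mul_C_mem_iff P₁ hd, ← neg_div, div_mul_cancel₀ _ hd0, neg_sub]
    exact ha)
  obtain ⟨s, hs, hs'⟩ := exists_placeFun_eq_one_le (mem_finiteElements_of_place_eq hP hfin) (by
    rw [← mul_C_mem_iff P₂ hd, sub_mul, div_mul_cancel₀ _ hd0, one_mul, map_sub, sub_sub,
      add_sub_cancel]
    exact ha2')
  rw [placeFun_eq_of_place_eq hP, hs', OnePoint.coe_eq_coe] at hr'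
  linarith

end FieldOrder

/-! ### Elements realizing a cut in the value group -/

namespace ArchimedeanClass

theorem mk_pow_lt_mk_pow {K : Type*} [Field K] [LinearOrder K] [IsStrictOrderedRing K]
    {a b : K} (h : mk a < mk b) {k : ℕ} (hk : k ≠ 0) : mk (a ^ k) < mk (b ^ k) := by
  have ha : a ≠ 0 := by rintro rfl; simp at h
  induction k with
  | zero => exact absurd rfl hk
  | succ k ih =>
    rcases eq_or_ne k 0 with rfl | hk0
    · simpa using h
    · rw [pow_succ, pow_succ]
      refine (mk_mul_lt_mk_mul ha (ih hk0)).trans_le ?_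
      rw [mk_mul, mk_mul]
      gcongr

open Classical in
/-- The value of `z` under the canonical real place of an ordered field: the standard part of `z`
if `z` is finite, and `∞` otherwise. -/
noncomputable def placeValue {K : Type*} [Field K] [LinearOrder K] [IsStrictOrderedRing K]
    (z : K) : OnePoint ℝ :=
  if 0 ≤ mk z then (stdPart z : ℝ) else OnePoint.infty

theorem placeValue_of_nonneg {K : Type*} [Field K] [LinearOrder K] [IsStrictOrderedRing K]
    {z : K} (h : 0 ≤ mk z) : placeValue z = (stdPart z : ℝ) :=
  if_pos h

theorem placeValue_of_not_nonneg {K : Type*} [Field K] [LinearOrder K] [IsStrictOrderedRing K]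
    {z : K} (h : ¬ 0 ≤ mk z) : placeValue z = OnePoint.infty :=
  if_neg h

/-- The nonzero element `y` of an ordered extension field of `R` realizes the cut `S` in the value
group of `R`: it is at most `c` in absolute value if `v c ∈ S`, and at least `c` if `v c ∉ S`, for
all `c > 0` in `R`. -/
def RealizesCut {R K : Type*} [Field R] [LinearOrder R] [IsStrictOrderedRing R] [Field K]
    [LinearOrder K] [IsStrictOrderedRing K] (φ : R →+*o K) (y : K)
    (S : Set (ArchimedeanClass R)) : Prop :=
  y ≠ 0 ∧ ∀ c : R, 0 < c → (mk c ∈ S → |y| ≤ φ c) ∧ (mk c ∉ S → φ c ≤ |y|)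

namespace RealizesCut

universe v

variable {R : Type*} {K : Type v} [Field R] [LinearOrder R] [IsStrictOrderedRing R] [Field K]
  [LinearOrder K] [IsStrictOrderedRing K] {φ : R →+*o K} {y : K} {S : Set (ArchimedeanClass R)}

theorem mk_map_lt (h : RealizesCut φ y S) {c : R} (hc : 0 < c) (hcS : mk c ∈ S) :
    mk (φ c) < mk y := by
  have hφ : StrictMono φ := φ.monotone'.strictMono_of_injective φ.toRingHom.injective
  have hφc : 0 < φ c := by simpa using hφ hc
  rw [mk_lt_mk]
  intro n
  -- The class of `c` does not change on division by `n + 1`.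
  have hn : mk (c / (n + 1)) ∈ S := by
    have : mk ((n : R) + 1) = 0 := by exact_mod_cast mk_natCast (S := R) n.succ_ne_zero
    rwa [mk_div, this, sub_zero]
  have h1 := (h.2 _ (by positivity)).1 hn
  rw [map_div₀, map_add, map_natCast, map_one, le_div_iff₀ (by positivity)] at h1
  rw [abs_of_pos hφc, nsmul_eq_mul]
  have := abs_pos.2 h.1
  linarith

theorem lt_mk_map (h : RealizesCut φ y S) {c : R} (hc : 0 < c) (hcS : mk c ∉ S) :
    mk y < mk (φ c) := by
  have hφ : StrictMono φ := φ.monotone'.strictMono_of_injective φ.toRingHom.injective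
  have hφc : 0 < φ c := by simpa using hφ hc
  rw [mk_lt_mk]
  intro n
  have hn : mk ((n + 1) * c) ∉ S := by
    have : mk ((n : R) + 1) = 0 := by exact_mod_cast mk_natCast (S := R) n.succ_ne_zero
    rwa [mk_mul, this, zero_add]
  have h1 := (h.2 _ (by positivity)).2 hn
  rw [map_mul, map_add, map_natCast, map_one] at h1
  rw [abs_of_pos hφc, nsmul_eq_mul]
  linarith

/-- Comparison of the monomials `c` and `d * y ^ k`. The quotient of `c` by `d` is `e ^ k` up to
sign, so that the result depends only on the position of the value of `e` with respect to `S`. -/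
theorem mk_map_lt_or_lt [IsRealClosed R] {c d : R} (hc : c ≠ 0) (hd : d ≠ 0) {k : ℕ} (hk : k ≠ 0)
    (S : Set (ArchimedeanClass R)) :
    (∀ (K : Type v) [Field K] [LinearOrder K] [IsStrictOrderedRing K] (φ : R →+*o K) (y : K),
      RealizesCut φ y S → mk (φ c) < mk (φ d * y ^ k)) ∨
    (∀ (K : Type v) [Field K] [LinearOrder K] [IsStrictOrderedRing K] (φ : R →+*o K) (y : K),
      RealizesCut φ y S → mk (φ d * y ^ k) < mk (φ c)) := by
  obtain ⟨e, he⟩ := IsRealClosed.exists_eq_pow_of_nonneg (abs_nonneg (c / d)) hk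
  wlog he0 : 0 ≤ e generalizing e
  · exact this |e| (by rw [← abs_pow, ← he, abs_abs]) (abs_nonneg e)
  have he_pos : 0 < e := by
    refine he0.lt_of_ne ?_
    rintro rfl
    rw [zero_pow hk, abs_eq_zero] at he
    exact div_ne_zero hc hd he
  have hmk : ∀ (K : Type v) [Field K] [LinearOrder K] [IsStrictOrderedRing K] (φ : R →+*o K),
      mk (φ c) = mk (φ e ^ k * φ d) := by
    intro K _ _ _ φ
    have h1 : |φ c| = |φ e ^ k * φ d| := by
      have habs : ∀ z : R, |φ z| = φ |z| := fun z => (map_abs φ z).symm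
      rw [← map_pow, ← map_mul, habs, habs, abs_mul, ← he, abs_abs, ← abs_mul, div_mul_cancel₀ _ hd]
    rw [← mk_abs, h1, mk_abs]
  by_cases heS : mk e ∈ S
  · left
    intro K _ _ _ φ y h
    rw [hmk, mul_comm (φ d)]
    exact mk_mul_lt_mk_mul ((map_ne_zero φ).2 hd) (mk_pow_lt_mk_pow (h.mk_map_lt he_pos heS) hk)
  · right
    intro K _ _ _ φ y h
    rw [hmk, mul_comm (φ d)]
    exact mk_mul_lt_mk_mul ((map_ne_zero φ).2 hd) (mk_pow_lt_mk_pow (h.lt_mk_map he_pos heS) hk)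

open Polynomial in
/-- A nonzero polynomial has a dominant monomial, which is the same at all elements realizing the
cut `S`: no two monomials of different degrees have the same value there. -/
theorem exists_dominant_monomial [IsRealClosed R] (S : Set (ArchimedeanClass R)) {p : R[X]}
    (hp : p ≠ 0) : ∃ m, p.coeff m ≠ 0 ∧
      ∀ (K : Type v) [Field K] [LinearOrder K] [IsStrictOrderedRing K] (φ : R →+*o K) (y : K),
        RealizesCut φ y S →
          mk (φ (p.coeff m) * y ^ m) < mk (p.eval₂ φ.toRingHom y - φ (p.coeff m) * y ^ m) := by
  induction p using Polynomial.recOnHorner with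
  | M0 => exact absurd rfl hp
  | MX p hp0 ih =>
    obtain ⟨m, hm, h⟩ := ih hp0
    refine ⟨m + 1, by rwa [coeff_mul_X], fun K _ _ _ φ y hy => ?_⟩
    rw [coeff_mul_X, eval₂_mul_X, pow_succ, ← mul_assoc, ← sub_mul]
    exact mk_mul_lt_mk_mul hy.1 (h K φ y hy)
  | MC p b hp0 hb ih =>
    have htop : ∀ (K : Type v) [Field K] [LinearOrder K] [IsStrictOrderedRing K] (φ : R →+*o K),
        mk (φ b) < mk (0 : K) := fun K _ _ _ φ => by
      rw [mk_zero, lt_top_iff_ne_top, ne_eq, mk_eq_top_iff]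
      exact (map_ne_zero φ).2 hb
    rcases eq_or_ne p 0 with rfl | hpne
    · refine ⟨0, by simpa using hb, fun K _ _ _ φ y hy => ?_⟩
      have h0 : (0 + C b : R[X]).eval₂ φ.toRingHom y = φ b := by
        rw [zero_add, eval₂_C]
        rfl
      rw [h0]
      simpa using htop K φ
    obtain ⟨m, hm, h⟩ := ih hpne
    have hm0 : m ≠ 0 := by
      rintro rfl
      exact hm hp0
    have heval : ∀ (K : Type v) [Field K] [LinearOrder K] [IsStrictOrderedRing K] (φ : R →+*o K)
        (y : K), (p + C b).eval₂ φ.toRingHom y = p.eval₂ φ.toRingHom y + φ b :=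
      fun K _ _ _ φ y => by
        rw [eval₂_add, eval₂_C]
        rfl
    rcases mk_map_lt_or_lt.{v} hb hm hm0 S with hlt | hlt
    · refine ⟨0, by simpa [hp0] using hb, fun K _ _ _ φ y hy => ?_⟩
      have h1 := mk_add_eq_mk_left (h K φ y hy)
      rw [add_sub_cancel] at h1
      have h2 := hlt K φ y hy
      rw [← h1] at h2
      rw [heval, coeff_add, hp0, coeff_C_zero, zero_add, pow_zero, mul_one, add_sub_cancel_right]
      exact h2
    · have hcoeff : (p + C b).coeff m = p.coeff m := by
        rw [coeff_add, coeff_C_of_ne_zero hm0, add_zero]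
      refine ⟨m, by rwa [hcoeff], fun K _ _ _ φ y hy => ?_⟩
      rw [hcoeff, heval, add_sub_right_comm]
      exact (lt_min (h K φ y hy) (hlt K φ y hy)).trans_le (min_le_mk_add _ _)

open Polynomial in
/-- The value of a rational function under the canonical place is the same at all elements realizing
the cut `S`: up to a factor infinitely close to `1` the rational function is
`(c / d) * y ^ (m - k)`, where `c * y ^ m` and `d * y ^ k` are the dominant monomials of numerator and denominator. If
`m ≠ k`, this is infinite or infinitesimal. -/
theorem exists_forall_placeValue_eq [IsRealClosed R] (S : Set (ArchimedeanClass R)) {p q : R[X]}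
    (hp : p ≠ 0) (hq : q ≠ 0) : ∃ r : OnePoint ℝ,
      ∀ (K : Type v) [Field K] [LinearOrder K] [IsStrictOrderedRing K] (φ : R →+*o K) (y : K),
        RealizesCut φ y S →
          placeValue (p.eval₂ φ.toRingHom y / q.eval₂ φ.toRingHom y) = r := by
  obtain ⟨m, hm, hpm⟩ := exists_dominant_monomial.{v} S hp
  obtain ⟨k, hk, hqk⟩ := exists_dominant_monomial.{v} S hq
  generalize p.coeff m = c at hm hpm
  generalize q.coeff k = d at hk hqk
  have key : ∀ (K : Type v) [Field K] [LinearOrder K] [IsStrictOrderedRing K] (φ : R →+*o K)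
      (y : K), RealizesCut φ y S →
      mk (φ c * y ^ m / (φ d * y ^ k)) <
        mk (p.eval₂ φ.toRingHom y / q.eval₂ φ.toRingHom y - φ c * y ^ m / (φ d * y ^ k)) :=
    fun K _ _ _ φ y hy => mk_div_lt_mk_div_sub_div (hpm K φ y hy) (hqk K φ y hy)
  have key' : ∀ (K : Type v) [Field K] [LinearOrder K] [IsStrictOrderedRing K] (φ : R →+*o K)
      (y : K), RealizesCut φ y S →
      mk (p.eval₂ φ.toRingHom y / q.eval₂ φ.toRingHom y) = mk (φ c * y ^ m / (φ d * y ^ k)) :=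
    fun K _ _ _ φ y hy => by
      have h1 := mk_add_eq_mk_left (key K φ y hy)
      rwa [add_sub_cancel] at h1
  have hzero : ∀ (K : Type v) [Field K] [LinearOrder K] [IsStrictOrderedRing K] (φ : R →+*o K)
      (y : K), RealizesCut φ y S → mk (φ d * y ^ k) < mk (φ c * y ^ m) →
      placeValue (p.eval₂ φ.toRingHom y / q.eval₂ φ.toRingHom y) = ((0 : ℝ) : OnePoint ℝ) := by
    intro K _ _ _ φ y hy h
    have hne : φ d * y ^ k ≠ 0 := mul_ne_zero ((map_ne_zero φ).2 hk) (pow_ne_zero _ hy.1)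
    have hpos := mk_mul_lt_mk_mul (inv_ne_zero hne) h
    rw [mul_inv_cancel₀ hne, ← div_eq_mul_inv, ← key' K φ y hy, mk_one] at hpos
    rw [placeValue_of_nonneg hpos.le, stdPart_of_mk_ne_zero hpos.ne']
  have hinfty : ∀ (K : Type v) [Field K] [LinearOrder K] [IsStrictOrderedRing K] (φ : R →+*o K)
      (y : K), RealizesCut φ y S → mk (φ c * y ^ m) < mk (φ d * y ^ k) →
      placeValue (p.eval₂ φ.toRingHom y / q.eval₂ φ.toRingHom y) = OnePoint.infty := by
    intro K _ _ _ φ y hy h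
    have hne : φ d * y ^ k ≠ 0 := mul_ne_zero ((map_ne_zero φ).2 hk) (pow_ne_zero _ hy.1)
    have hneg := mk_mul_lt_mk_mul (inv_ne_zero hne) h
    rw [mul_inv_cancel₀ hne, ← div_eq_mul_inv, ← key' K φ y hy, mk_one] at hneg
    exact placeValue_of_not_nonneg hneg.not_ge
  -- A common power of `y` may be cancelled in the comparison of the two monomials.
  have hcancel : ∀ (c d : R) (n l : ℕ) (K : Type v) [Field K] [LinearOrder K]
      [IsStrictOrderedRing K] (φ : R →+*o K) (y : K), RealizesCut φ y S →
      (mk (φ c) < mk (φ d * y ^ l) → mk (φ c * y ^ n) < mk (φ d * y ^ (n + l))) ∧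
      (mk (φ d * y ^ l) < mk (φ c) → mk (φ d * y ^ (n + l)) < mk (φ c * y ^ n)) := by
    intro c d n l K _ _ _ φ y hy
    rw [pow_add, mul_comm (y ^ n), ← mul_assoc]
    exact ⟨mk_mul_lt_mk_mul (pow_ne_zero _ hy.1), mk_mul_lt_mk_mul (pow_ne_zero _ hy.1)⟩
  rcases lt_trichotomy m k with hlt | rfl | hlt
  · obtain ⟨l, rfl⟩ := Nat.exists_eq_add_of_le hlt.le
    rcases mk_map_lt_or_lt.{v} hm hk (k := l) (by omega) S with h | h
    · exact ⟨_, fun K _ _ _ φ y hy =>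
        hinfty K φ y hy ((hcancel c d m l K φ y hy).1 (h K φ y hy))⟩
    · exact ⟨_, fun K _ _ _ φ y hy => hzero K φ y hy ((hcancel c d m l K φ y hy).2 (h K φ y hy))⟩
  · refine ⟨placeValue (c / d), fun K _ _ _ φ y hy => ?_⟩
    have hquot : φ c * y ^ m / (φ d * y ^ m) = φ (c / d) := by
      rw [mul_div_mul_right _ _ (pow_ne_zero _ hy.1), map_div₀]
    have hnonneg : 0 ≤ mk (φ (c / d)) ↔ 0 ≤ mk (c / d) := by
      rw [← mk_one (R := K), ← map_one φ, mk_map_le_mk_map, mk_one]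
    have h1 := key K φ y hy
    have h2 := key' K φ y hy
    rw [hquot] at h1 h2
    by_cases hcd : 0 ≤ mk (c / d)
    · have h3 := stdPart_add_eq_left (x := φ (c / d)) ((hnonneg.2 hcd).trans_lt h1)
      rw [add_sub_cancel, stdPart_map φ hcd] at h3
      rw [placeValue_of_nonneg hcd, placeValue_of_nonneg (by rwa [h2, hnonneg]), h3]
    · rw [placeValue_of_not_nonneg hcd, placeValue_of_not_nonneg (by rwa [h2, hnonneg])]
  · obtain ⟨l, rfl⟩ := Nat.exists_eq_add_of_le hlt.le
    rcases mk_map_lt_or_lt.{v} hk hm (k := l) (by omega) S with h | h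
    · exact ⟨_, fun K _ _ _ φ y hy => hzero K φ y hy ((hcancel d c k l K φ y hy).1 (h K φ y hy))⟩
    · exact ⟨_, fun K _ _ _ φ y hy =>
        hinfty K φ y hy ((hcancel d c k l K φ y hy).2 (h K φ y hy))⟩

end RealizesCut

end ArchimedeanClass

/-! ### Equality of places -/

namespace FieldOrder

open ArchimedeanClass

theorem placeFun_eq_placeValue {K : Type*} [Field K] (P : RingPreordering K) [P.IsOrdering]
    (f : K) :
    letI := linearOrder P
    haveI : IsStrictOrderedRing K := isStrictOrderedRing P
    placeFun P f = placeValue f := by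
  let _ := linearOrder P
  have : IsStrictOrderedRing K := isStrictOrderedRing P
  unfold placeFun
  split_ifs with h
  · exact (placeValue_of_nonneg ((mem_finiteElements_iff P f).1 h)).symm
  · exact (placeValue_of_not_nonneg (mt (mem_finiteElements_iff P f).2 h)).symm

variable {R : Type*} [Field R] [LinearOrder R] [IsStrictOrderedRing R] [IsRealClosed R]

/-- The embedding of `R` in `R(X)` with the order `P`, as a homomorphism of ordered fields. -/
noncomputable def orderEmbedding (P : RingPreordering (RatFunc R)) [P.IsOrdering] :
    letI := linearOrder P
    R →+*o RatFunc R :=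
  letI := linearOrder P
  { RatFunc.C with
    monotone' := fun _ _ h => (C_sub_C_mem_iff P).2 h }

/-- If `X - a` realizes the same cut in the value group for two orders of `R(X)`, then the two
places coincide. -/
theorem place_eq_of_realizesCut {P₁ P₂ : RingPreordering (RatFunc R)} [P₁.IsOrdering]
    [P₂.IsOrdering] {a : R} {S : Set (ArchimedeanClass R)}
    (h : ∀ (P : RingPreordering (RatFunc R)) [P.IsOrdering], P = P₁ ∨ P = P₂ →
      letI := linearOrder P
      haveI : IsStrictOrderedRing (RatFunc R) := isStrictOrderedRing P
      RealizesCut (orderEmbedding P) (RatFunc.X - RatFunc.C a) S) :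
    place P₁ = place P₂ := by
  refine RealPlace.ext (funext fun f => ?_)
  by_cases hf : f = 0
  · have h0 : ∀ (P : RingPreordering (RatFunc R)) [P.IsOrdering],
        placeFun P f = ((0 : ℝ) : OnePoint ℝ) := fun P _ => by
      let _ := linearOrder P
      have : IsStrictOrderedRing (RatFunc R) := isStrictOrderedRing P
      rw [placeFun_eq_coe_iff, mem_finiteElements_iff, hf]
      exact ⟨by simp, stdPart_zero⟩
    exact (h0 P₁).trans (h0 P₂).symm
  -- Numerator and denominator are expanded in powers of `X - a`.
  obtain ⟨r, hr⟩ := RealizesCut.exists_forall_placeValue_eq S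
    (p := Polynomial.taylor a f.num) (q := Polynomial.taylor a f.denom)
    (by simpa [Polynomial.taylor_eq_zero] using hf)
    (by simpa [Polynomial.taylor_eq_zero] using RatFunc.denom_ne_zero f)
  have heval : ∀ p : Polynomial R,
      (Polynomial.taylor a p).eval₂ RatFunc.C (RatFunc.X - RatFunc.C a) =
        algebraMap (Polynomial R) (RatFunc R) p := fun p => by
    rw [Polynomial.taylor_apply, Polynomial.eval₂_comp, Polynomial.eval₂_add, Polynomial.eval₂_X,
      Polynomial.eval₂_C, sub_add_cancel, ← RatFunc.aeval_X_left_eq_algebraMap]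
    rfl
  have hval : ∀ (P : RingPreordering (RatFunc R)) [P.IsOrdering], P = P₁ ∨ P = P₂ →
      placeFun P f = r := fun P _ hP => by
    let _ := linearOrder P
    have : IsStrictOrderedRing (RatFunc R) := isStrictOrderedRing P
    rw [placeFun_eq_placeValue, ← hr (RatFunc R) (orderEmbedding P) _ (h P hP)]
    have hC : (orderEmbedding P).toRingHom = RatFunc.C := rfl
    rw [hC, heval, heval, RatFunc.num_div_denom]
  exact (hval P₁ (Or.inl rfl)).trans (hval P₂ (Or.inr rfl)).symm

/-- If `a` lies between the two cuts and no distance between two points there belongs to the common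
cut `S` in the value group, then `X - a` realizes `S` for both orders. -/
theorem place_eq_of_inter_distanceCut_eq_empty {P₁ P₂ : RingPreordering (RatFunc R)}
    [P₁.IsOrdering] [P₂.IsOrdering] (hsub : DedekindCut.lower P₁ ⊆ DedekindCut.lower P₂)
    (hS : DedekindCut.valueCut (DedekindCut.lower P₁) (DedekindCut.upper P₁) =
      DedekindCut.valueCut (DedekindCut.lower P₂) (DedekindCut.upper P₂))
    (hU : DedekindCut.valueCut (DedekindCut.lower P₁) (DedekindCut.upper P₁) ∩
      DedekindCut.distanceCut (DedekindCut.upper P₁) (DedekindCut.lower P₂) = ∅) :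
    place P₁ = place P₂ := by
  by_cases heq : DedekindCut.lower P₂ ⊆ DedekindCut.lower P₁
  · obtain rfl := eq_of_lower_eq P₁ P₂ (hsub.antisymm heq)
    rfl
  obtain ⟨a, ha₂, ha₁⟩ := Set.not_subset.1 heq
  rw [← mem_upper_iff_notMem_lower] at ha₁
  have hdist : ∀ x y : R, x ∈ DedekindCut.upper P₁ → x ∈ DedekindCut.lower P₂ →
      y ∈ DedekindCut.upper P₁ → y ∈ DedekindCut.lower P₂ → x < y →
      mk (y - x) ∉ DedekindCut.valueCut (DedekindCut.lower P₁) (DedekindCut.upper P₁) :=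
    fun x y h1 h2 h3 h4 hxy hmem =>
      Set.eq_empty_iff_forall_notMem.1 hU _ ⟨hmem, x, ⟨h1, h2⟩, y, ⟨h3, h4⟩, hxy, rfl⟩
  refine place_eq_of_realizesCut (a := a)
    (S := DedekindCut.valueCut (DedekindCut.lower P₁) (DedekindCut.upper P₁)) ?_
  rintro P _ hP
  let _ := linearOrder P
  have : IsStrictOrderedRing (RatFunc R) := isStrictOrderedRing P
  have hφ : ∀ c : R, orderEmbedding P c = RatFunc.C c := fun _ => rfl
  have hlow : ∀ x : R, x ∈ DedekindCut.lower P ↔ RatFunc.C x ≤ RatFunc.X := fun _ => Iff.rfl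
  have hupp : ∀ x : R, x ∈ DedekindCut.upper P ↔ RatFunc.X ≤ RatFunc.C x := fun _ => Iff.rfl
  refine ⟨X_sub_C_ne_zero a, fun c hc => ⟨fun hcS => ?_, fun hcS => ?_⟩⟩
  · suffices a - c ∈ DedekindCut.lower P ∧ a + c ∈ DedekindCut.upper P by
      rw [hlow, hupp, map_sub, map_add] at this
      rw [hφ, abs_le]
      constructor <;> linarith [this.1, this.2]
    rcases hP with rfl | rfl
    · refine ⟨?_, mem_upper_of_le ha₁ (by linarith)⟩
      by_contra hn
      rw [← mem_upper_iff_notMem_lower] at hn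
      refine hdist (a - c) a hn (mem_lower_of_le ha₂ (by linarith)) ha₁ ha₂ (by linarith) ?_
      rwa [sub_sub_cancel]
    · refine ⟨mem_lower_of_le ha₂ (by linarith), ?_⟩
      rw [mem_upper_iff_notMem_lower]
      intro hn
      refine hdist a (a + c) ha₁ ha₂ (mem_upper_of_le ha₁ (by linarith)) hn (by linarith) ?_
      rwa [add_sub_cancel_left]
  · suffices a + c ∈ DedekindCut.lower P ∨ a - c ∈ DedekindCut.upper P by
      rw [hlow, hupp, map_sub, map_add] at this
      rw [hφ, le_abs]
      rcases this with h | h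
      · left; linarith
      · right; linarith
    rcases hP with rfl | rfl
    · right
      rw [mem_upper_iff_notMem_lower]
      intro hn
      exact hcS ⟨a - c, hn, a, ha₁, by rw [sub_sub_cancel]⟩
    · left
      by_contra hn
      rw [← mem_upper_iff_notMem_lower] at hn
      rw [hS] at hcS
      exact hcS ⟨a, ha₂, a + c, hn, by rw [add_sub_cancel_left]⟩

/-! ### Pairs of orders with the same place -/

/-- If the values of all positive elements lie in the value cut, then two points between the
cuts would have a distance with value in it, so there is only one such point. -/
theorem lower_upper_eq_of_forall_mem_valueCut {P₁ P₂ : RingPreordering (RatFunc R)}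
    [P₁.IsOrdering] [P₂.IsOrdering] (hne : P₁ ≠ P₂)
    (hsub : DedekindCut.lower P₁ ⊆ DedekindCut.lower P₂)
    (hU : DedekindCut.valueCut (DedekindCut.lower P₁) (DedekindCut.upper P₁) ∩
      DedekindCut.distanceCut (DedekindCut.upper P₁) (DedekindCut.lower P₂) = ∅)
    (hnormal : ∀ c : R, 0 < c →
      mk c ∈ DedekindCut.valueCut (DedekindCut.lower P₁) (DedekindCut.upper P₁)) :
    ∃ a : R, DedekindCut.lower P₁ = Set.Iio a ∧ DedekindCut.upper P₁ = Set.Ici a ∧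
      DedekindCut.lower P₂ = Set.Iic a ∧ DedekindCut.upper P₂ = Set.Ioi a := by
  obtain ⟨a, ha₂, ha₁⟩ := Set.not_subset.1
    fun heq => hne (eq_of_lower_eq P₁ P₂ (hsub.antisymm heq))
  rw [← mem_upper_iff_notMem_lower] at ha₁
  have hdist : ∀ x y : R, x ∈ DedekindCut.upper P₁ → y ∈ DedekindCut.lower P₂ → ¬ x < y :=
    fun x y hx hy hxy => Set.eq_empty_iff_forall_notMem.1 hU _ ⟨hnormal _ (sub_pos.2 hxy), x,
      ⟨hx, mem_lower_of_le hy hxy.le⟩, y, ⟨mem_upper_of_le hx hxy.le, hy⟩, hxy, rfl⟩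
  have hU₁ : DedekindCut.upper P₁ = Set.Ici a :=
    Set.ext fun x => ⟨fun hx => not_lt.1 (hdist x a hx ha₂), fun hx => mem_upper_of_le ha₁ hx⟩
  have hL₂ : DedekindCut.lower P₂ = Set.Iic a :=
    Set.ext fun x => ⟨fun hx => not_lt.1 (hdist a x ha₁ hx), fun hx => mem_lower_of_le ha₂ hx⟩
  refine ⟨a, Set.ext fun x => ?_, hU₁, hL₂, Set.ext fun x => ?_⟩
  · rw [← not_iff_not, ← mem_upper_iff_notMem_lower, hU₁, Set.mem_Ici, Set.mem_Iio, not_lt]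
  · rw [mem_upper_iff_notMem_lower, hL₂, Set.mem_Iic, Set.mem_Ioi, not_le]

theorem mk_mem_valueCut_of_isNormal {P : RingPreordering (RatFunc R)} [P.IsOrdering]
    (h : DedekindCut.IsNormal (DedekindCut.lower P) (DedekindCut.upper P)) {c : R} (hc : 0 < c) :
    mk c ∈ DedekindCut.valueCut (DedekindCut.lower P) (DedekindCut.upper P) := by
  obtain ⟨a, ha, b, hb, hab⟩ := h c hc
  exact ⟨b - c, mem_lower_of_le ha (by linarith), b, hb, by rw [sub_sub_cancel]⟩

omit [IsRealClosed R] in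
theorem isAbnormalGap_of_not_isNormal {P : RingPreordering (RatFunc R)} [P.IsOrdering]
    (hA : (DedekindCut.lower P).Nonempty) (hB : (DedekindCut.upper P).Nonempty)
    (h : ¬ DedekindCut.IsNormal (DedekindCut.lower P) (DedekindCut.upper P)) :
    DedekindCut.IsAbnormalGap (DedekindCut.lower P) (DedekindCut.upper P) := by
  refine ⟨⟨hA, hB, ?_, ?_⟩, h⟩
  · rintro ⟨a, ha, hmax⟩
    refine h fun c hc => ⟨a, ha, a + c / 2, ?_, by linarith⟩
    rw [mem_upper_iff_notMem_lower]
    intro hn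
    have := hmax hn
    linarith
  · rintro ⟨b, hb, hmin⟩
    refine h fun c hc => ⟨b - c / 2, ?_, b, hb, by linarith⟩
    by_contra hn
    have := hmin ((mem_upper_iff_notMem_lower P).2 hn)
    linarith

omit [IsRealClosed R] in
theorem valueCut_Iio_Ici_eq (a : R) :
    DedekindCut.valueCut (Set.Iio a) (Set.Ici a) =
      DedekindCut.valueCut (Set.Iic a) (Set.Ioi a) := by
  ext γ
  constructor
  · rintro ⟨x, hx, y, hy, rfl⟩
    have hxy : x < y := lt_of_lt_of_le hx hy
    exact ⟨a, le_rfl, a + (y - x), by simpa using hxy, by rw [add_sub_cancel_left]⟩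
  · rintro ⟨x, hx, y, hy, rfl⟩
    have hxy : x < y := lt_of_le_of_lt hx hy
    exact ⟨a - (y - x), by simpa using hxy, a, le_rfl, by rw [sub_sub_cancel]⟩

theorem place_eq_iff {P₁ P₂ : RingPreordering (RatFunc R)} [P₁.IsOrdering] [P₂.IsOrdering]
    (hsub : DedekindCut.lower P₁ ⊆ DedekindCut.lower P₂) :
    place P₁ = place P₂ ↔
      DedekindCut.valueCut (DedekindCut.lower P₁) (DedekindCut.upper P₁) =
        DedekindCut.valueCut (DedekindCut.lower P₂) (DedekindCut.upper P₂) ∧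
      DedekindCut.valueCut (DedekindCut.lower P₁) (DedekindCut.upper P₁) ∩
        DedekindCut.distanceCut (DedekindCut.upper P₁) (DedekindCut.lower P₂) = ∅ := by
  refine ⟨fun h => ⟨?_, ?_⟩, fun h => place_eq_of_inter_distanceCut_eq_empty hsub h.1 h.2⟩
  · exact (valueCut_subset_of_place_eq h).antisymm (valueCut_subset_of_place_eq h.symm)
  · by_contra hne
    exact place_ne_of_inter_distanceCut_nonempty (Set.nonempty_iff_ne_empty.2 hne) h

end FieldOrder

open DedekindCut FieldOrder in
theorem mainTheorem1 {R : Type*} [Field R] [LinearOrder R] [IsStrictOrderedRing R] [IsRealClosed R]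
    (P₁ P₂ : RingPreordering (RatFunc R)) [P₁.IsOrdering] [P₂.IsOrdering]
    (A₁ B₁ A₂ B₂ : Set R)
    (hA₁ : A₁ = DedekindCut.lower P₁) (hB₁ : B₁ = DedekindCut.upper P₁)
    (hA₂ : A₂ = DedekindCut.lower P₂) (hB₂ : B₂ = DedekindCut.upper P₂)
    (S₁ S₂ U : Set (ArchimedeanClass R))
    (hS₁ : S₁ = DedekindCut.valueCut A₁ B₁) (hS₂ : S₂ = DedekindCut.valueCut A₂ B₂)
    (hU : U = DedekindCut.distanceCut B₁ A₂) :
    (S₁ ≠ S₂ → FieldOrder.place P₁ ≠ FieldOrder.place P₂) ∧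
    (A₁ ⊆ A₂ →
      (S₁ = S₂ → (S₁ ∩ U).Nonempty → FieldOrder.place P₁ ≠ FieldOrder.place P₂) ∧
      (S₁ = S₂ → S₁ ∩ U = ∅ → FieldOrder.place P₁ = FieldOrder.place P₂) ∧
      (P₁ ≠ P₂ →
        (FieldOrder.place P₁ = FieldOrder.place P₂ ↔
          (∃ a : R, A₁ = Set.Iio a ∧ B₁ = Set.Ici a ∧ A₂ = Set.Iic a ∧ B₂ = Set.Ioi a) ∨
          (A₁ = ∅ ∧ B₁ = Set.univ ∧ A₂ = Set.univ ∧ B₂ = ∅) ∨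
          (DedekindCut.IsAbnormalGap A₁ B₁ ∧ DedekindCut.IsAbnormalGap A₂ B₂ ∧
            S₁ = S₂ ∧ S₁ ∩ U = ∅)))) := by
  subst hS₁ hS₂ hU
  refine ⟨fun hS hP => ?_, fun hsub => ⟨fun _ hne => ?_, fun hS hU => ?_, fun hne => ⟨?_, ?_⟩⟩⟩
  · subst hA₁ hB₁ hA₂ hB₂
    exact hS ((valueCut_subset_of_place_eq hP).antisymm (valueCut_subset_of_place_eq hP.symm))
  · subst hA₁ hB₁ hA₂ hB₂
    exact place_ne_of_inter_distanceCut_nonempty hne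
  · subst hA₁ hB₁ hA₂ hB₂
    exact place_eq_of_inter_distanceCut_eq_empty hsub hS hU
  · subst hA₁ hB₁ hA₂ hB₂
    intro hP
    obtain ⟨hS, hU⟩ := (place_eq_iff hsub).1 hP
    have hlow : lower P₁ ≠ lower P₂ := fun h => hne (eq_of_lower_eq P₁ P₂ h)
    by_cases h₁ : IsNormal (lower P₁) (upper P₁)
    · exact Or.inl (lower_upper_eq_of_forall_mem_valueCut hne hsub hU
        fun c hc => mk_mem_valueCut_of_isNormal h₁ hc)
    by_cases h₂ : IsNormal (lower P₂) (upper P₂)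
    · exact Or.inl (lower_upper_eq_of_forall_mem_valueCut hne hsub hU
        fun c hc => hS ▸ mk_mem_valueCut_of_isNormal h₂ hc)
    have hcompl : ∀ (P : RingPreordering (RatFunc R)) [P.IsOrdering],
        upper P = (lower P)ᶜ := fun P _ => Set.ext fun x => mem_upper_iff_notMem_lower P
    have hA₂ : (lower P₂).Nonempty := by
      rw [Set.nonempty_iff_ne_empty]
      exact fun h => hlow (by rw [h]; exact Set.subset_empty_iff.1 (h ▸ hsub))
    have hB₁ : (upper P₁).Nonempty := by
      rw [hcompl, Set.nonempty_compl]
      exact fun h => hlow (by rw [h]; exact (Set.univ_subset_iff.1 (h ▸ hsub)).symm)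
    -- The cuts are proper or improper together, since `S` is empty exactly for an improper cut.
    have hiff : (lower P₁).Nonempty ↔ (upper P₂).Nonempty := by
      constructor
      · rintro ⟨x, hx⟩
        obtain ⟨y, hy⟩ := hB₁
        have hmem : ArchimedeanClass.mk (y - x) ∈ valueCut (lower P₁) (upper P₁) :=
          ⟨x, hx, y, hy, rfl⟩
        rw [hS] at hmem
        obtain ⟨-, -, z, hz, -⟩ := hmem
        exact ⟨z, hz⟩
      · rintro ⟨y, hy⟩
        obtain ⟨x, hx⟩ := hA₂
        have hmem : ArchimedeanClass.mk (y - x) ∈ valueCut (lower P₂) (upper P₂) :=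
          ⟨x, hx, y, hy, rfl⟩
        rw [← hS] at hmem
        obtain ⟨z, hz, -⟩ := hmem
        exact ⟨z, hz⟩
    right
    by_cases hA₁ : (lower P₁).Nonempty
    · exact Or.inr ⟨isAbnormalGap_of_not_isNormal hA₁ hB₁ h₁,
        isAbnormalGap_of_not_isNormal hA₂ (hiff.1 hA₁) h₂, hS, hU⟩
    · have hB₂ := mt hiff.2 hA₁
      rw [Set.not_nonempty_iff_eq_empty] at hA₁ hB₂
      refine Or.inl ⟨hA₁, by rw [hcompl, hA₁, Set.compl_empty], ?_, hB₂⟩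
      rwa [hcompl, Set.compl_empty_iff] at hB₂
  · intro h
    suffices hSU : valueCut A₁ B₁ = valueCut A₂ B₂ ∧ valueCut A₁ B₁ ∩ distanceCut B₁ A₂ = ∅ by
      subst hA₁ hB₁ hA₂ hB₂
      exact (place_eq_iff hsub).2 hSU
    clear hA₁ hB₁ hA₂ hB₂
    rcases h with ⟨a, rfl, rfl, rfl, rfl⟩ | ⟨rfl, rfl, rfl, rfl⟩ | ⟨-, -, h⟩
    · refine ⟨valueCut_Iio_Ici_eq a, Set.eq_empty_iff_forall_notMem.2 ?_⟩
      -- The only point between the two cuts is `a`.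
      rintro _ ⟨-, x, ⟨hx, -⟩, y, ⟨-, hy⟩, hxy, -⟩
      exact absurd hxy (not_lt.2 (le_trans hy hx))
    · simp [valueCut]
    · exact h
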